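/- Let $(R,\mathfrak m)$ be a commutative noetherian local ring. For an $R$-module $M$ let $\widehat M=\varprojlim_n M/\mathfrak m^nM$ be its $\mathfrak m$-adic completion; $M$ is called separated if $\bigcap_{n\ge 1}\mathfrak m^nM=0$ (so that $M\subset\widehat M$ canonically), and totally separated if $X\otimes_R M$ is separated for every finitely generated $R$-module $X$. For an $R$-module $N$ let $\operatorname{Koass}(N)$ denote the set of coassociated prime ideals of $N$, i.e. the set of all $\mathfrak p\in\operatorname{Spec}(R)$ such that $\mathfrak p=\operatorname{Ann}_R(N/U)$ for some submodule $U\subset N$ with $N/U$ artinian. (1) Let $M=\bigoplus_{i\in I}M_i$ be totally separated and flat, with $M_i\neq 0$ for infinitely many $i\in I$. Then $$\operatorname{Koass}(\widehat M/M)=\operatorname{Spec}(R)\setminus\{\mathfrak m\}.$$ (2) Let $M=X^{(I)}=\bigoplus_{i\in I}X$ with $X$ a finitely generated nonzero $R$-module and $I$ an infinite set. Then $$\operatorname{Koass}(\widehat M/M)=\{\mathfrak p\in\operatorname{Spec}(R)\mid \operatorname{Ann}_R(X)\subset\mathfrak p\subsetneq\mathfrak m\}.$$ -/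

import Mathlib

open scoped DirectSum TensorProduct

universe u v w

/-- A module `M` over a local ring `R` is totally separated if `X ⊗ M` is separated in the topology
of the maximal ideal for every finitely generated `R`-module `X`. Every finitely generated module
is isomorphic to a quotient of some `Fin n → R`, so modules `X` in the universe of `R` suffice. -/
def IsTotallySeparatedModule (R : Type u) [CommRing R] [IsLocalRing R]
    (M : Type v) [AddCommGroup M] [Module R M] : Prop :=
  ∀ (X : Type u) [AddCommGroup X] [Module R X], Module.Finite R X →
    IsHausdorff (IsLocalRing.maximalIdeal R) (X ⊗[R] M)

/-- The set of coassociated primes of `N`: those primes that are the annihilator of some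
artinian factor module of `N`. -/
def coassociatedPrimes (R : Type u) [CommRing R]
    (N : Type v) [AddCommGroup N] [Module R N] : Set (PrimeSpectrum R) :=
  {p | ∃ U : Submodule R N, IsArtinian R (N ⧸ U) ∧ Module.annihilator R (N ⧸ U) = p.asIdeal}

/-- The cokernel of the canonical map from `M` to its completion with respect to the maximal
ideal of the local ring `R`. -/
abbrev CompletionQuotient (R : Type u) [CommRing R] [IsLocalRing R]
    (M : Type v) [AddCommGroup M] [Module R M] : Type _ :=
  AdicCompletion (IsLocalRing.maximalIdeal R) M ⧸
    LinearMap.range (AdicCompletion.of (IsLocalRing.maximalIdeal R) M)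

/-! ### Artinianness detected on torsion submodules. -/

section Artinian

variable {R : Type*} [CommRing R] {M : Type*} [AddCommGroup M] [Module R M]

/-! Write `N` for the completion of `M` modulo `M`. Density of `M` gives `𝔪N = N`, so no nonzero
quotient of `N` is killed by `𝔪`; also `Ann M` kills `N`. This bounds the coassociated primes from
above.

Conversely, let `p ⊊ 𝔪`. Finite modules `L k`, killed by `p + 𝔪 ^ (c + k)` for a fixed `c`, are
built with socle elements `s k ≠ 0` such that each `r ∉ p` divides `s k` for large `k`, with
quotients tending to zero. In the completion of `⨁ L k` modulo `⨁ L k`, the class of `∑ s k` is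
nonzero, killed by `𝔪` and divisible by every `r ∉ p`. By Zorn it survives in an artinian quotient,
whose annihilator is then `p` (`mem_coassociatedPrimes_of_socle`).

It remains to map `M` onto `⨁ L k`, since completion quotients preserve surjections. Each `L k` is
generated by images of an ideal `J ⊄ p`, and each summand of `M` maps onto the image of `J` in `R ⧸
(p + 𝔪 ^ n)`: by freeness modulo `p + 𝔪 ^ n` in the flat case, by a nonzero map `X → R ⧸ p` in the
finite case. -/

/-- For a submodule `U`, the submodule `x ^ n • (U ∩ Ann (x ^ (n + 1)))`. -/
def leadingSubmodule (x : R) (U : Submodule R M) (n : ℕ) : Submodule R M :=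
  (U ⊓ Submodule.torsionBy R M (x ^ (n + 1))).map (LinearMap.lsmul R M (x ^ n))

theorem mem_leadingSubmodule {x : R} {U : Submodule R M} {n : ℕ} {y : M} :
    y ∈ leadingSubmodule x U n ↔ ∃ u ∈ U, x ^ (n + 1) • u = 0 ∧ x ^ n • u = y := by
  simp [leadingSubmodule, and_assoc]

theorem leadingSubmodule_mono {x : R} {U V : Submodule R M} (h : U ≤ V) (n : ℕ) :
    leadingSubmodule x U n ≤ leadingSubmodule x V n :=
  Submodule.map_mono (inf_le_inf_right _ h)

theorem leadingSubmodule_antitone (x : R) (U : Submodule R M) :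
    Antitone (leadingSubmodule x U) := by
  refine antitone_nat_of_succ_le fun n y hy ↦ ?_
  obtain ⟨u, hu, h0, rfl⟩ := mem_leadingSubmodule.1 hy
  refine mem_leadingSubmodule.2 ⟨x • u, U.smul_mem _ hu, ?_, ?_⟩
  · rw [smul_smul, ← pow_succ, h0]
  · rw [smul_smul, ← pow_succ]

theorem leadingSubmodule_le (x : R) (U : Submodule R M) (n : ℕ) :
    leadingSubmodule x U n ≤ Submodule.torsionBy R M x := by
  intro y hy
  obtain ⟨u, hu, h0, rfl⟩ := mem_leadingSubmodule.1 hy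
  rw [Submodule.mem_torsionBy_iff, smul_smul, ← pow_succ', h0]

/-- Induction on the power of `x` killing `u`: subtracting some `v ∈ V` with the same leading term
lowers that power. -/
theorem le_of_leadingSubmodule_le {x : R} (htors : ∀ y : M, ∃ n : ℕ, x ^ n • y = 0)
    {U V : Submodule R M} (hVU : V ≤ U)
    (h : ∀ n, leadingSubmodule x U n ≤ leadingSubmodule x V n) : U ≤ V := by
  have key : ∀ n : ℕ, ∀ u ∈ U, x ^ n • u = 0 → u ∈ V := by
    intro n
    induction n with
    | zero => intro u _ h0; simp_all
    | succ n ih =>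
      intro u hu h0
      obtain ⟨v, hv, hv0, hvu⟩ := mem_leadingSubmodule.1
        (h n (mem_leadingSubmodule.2 ⟨u, hu, h0, rfl⟩))
      have := ih (u - v) (U.sub_mem hu (hVU hv)) (by rw [smul_sub, hvu, sub_self])
      simpa using V.add_mem this hv
  intro u hu
  obtain ⟨n, hn⟩ := htors u
  exact key n u hu hn

theorem Antitone.stabilizes_of_le_isArtinian {W : Submodule R M} [IsArtinian R W]
    {g : ℕ → Submodule R M} (hg : Antitone g) (hW : ∀ n, g n ≤ W) :
    ∃ n, ∀ m, n ≤ m → g n = g m := by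
  obtain ⟨n, hn⟩ := IsArtinian.monotone_stabilizes (R := R) (M := W)
    ⟨fun n ↦ OrderDual.toDual ((g n).comap W.subtype),
      fun a b hab ↦ Submodule.comap_mono (hg hab)⟩
  refine ⟨n, fun m hm ↦ ?_⟩
  have : ((g n).comap W.subtype).map W.subtype = ((g m).comap W.subtype).map W.subtype :=
    congrArg (Submodule.map W.subtype) (hn m hm)
  simpa [Submodule.map_comap_subtype, inf_eq_right.2 (hW _)] using this

/-- A module all of whose elements are killed by a power of `x` is artinian if its `x`-torsion
is. -/
theorem isArtinian_of_isArtinian_torsionBy (x : R) (htors : ∀ y : M, ∃ n : ℕ, x ^ n • y = 0)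
    [IsArtinian R (Submodule.torsionBy R M x)] : IsArtinian R M := by
  rw [← monotone_stabilizes_iff_artinian]
  intro f
  set U : ℕ → Submodule R M := fun j ↦ OrderDual.ofDual (f j) with hU
  have hanti : Antitone U := fun a b hab ↦ f.monotone hab
  -- The diagonal controls all degrees `n ≥ N` at once; the finitely many degrees below `N`
  -- stabilize separately.
  obtain ⟨N, hN⟩ := Antitone.stabilizes_of_le_isArtinian
    (g := fun j ↦ leadingSubmodule x (U j) j)
    (fun a b hab ↦ (leadingSubmodule_mono (hanti hab) _).trans
      (leadingSubmodule_antitone x (U a) hab)) (fun _ ↦ leadingSubmodule_le x _ _)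
  have hcol : ∀ n, ∃ k, ∀ m, k ≤ m → leadingSubmodule x (U k) n = leadingSubmodule x (U m) n :=
    fun n ↦ Antitone.stabilizes_of_le_isArtinian (g := fun j ↦ leadingSubmodule x (U j) n)
      (fun a b hab ↦ leadingSubmodule_mono (hanti hab) _) (fun _ ↦ leadingSubmodule_le x _ _)
  choose k hk using hcol
  set K := N + (Finset.range N).sup k with hK
  refine ⟨K, fun m hm ↦ ?_⟩
  refine le_antisymm (α := Submodule R M) ?_ (hanti hm)
  refine le_of_leadingSubmodule_le htors (hanti hm) fun n ↦ ?_
  rcases lt_or_ge n N with hn | hn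
  · have h1 : k n ≤ K := (Finset.le_sup (f := k) (Finset.mem_range.2 hn)).trans (by omega)
    exact ((hk n K h1).symm.trans (hk n m (h1.trans hm))).le
  · calc leadingSubmodule x (U K) n ≤ leadingSubmodule x (U N) N :=
          (leadingSubmodule_mono (hanti (by omega)) n).trans (leadingSubmodule_antitone x _ hn)
      _ = leadingSubmodule x (U (max n m)) (max n m) := hN _ (by omega)
      _ ≤ leadingSubmodule x (U m) n :=
          (leadingSubmodule_mono (hanti (le_max_right _ _)) _).trans
            (leadingSubmodule_antitone x _ (le_max_left _ _))

/-- The torsion of `insert x s` is the `s`-torsion of the `x`-torsion, so one element is handled at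
a time. -/
theorem isArtinian_of_isArtinian_torsionBySet [DecidableEq R] (s : Finset R) :
    ∀ {M : Type*} [AddCommGroup M] [Module R M]
    (_ : ∀ x ∈ s, ∀ y : M, ∃ n : ℕ, x ^ n • y = 0)
    [IsArtinian R (Submodule.torsionBySet R M (s : Set R))], IsArtinian R M := by
  induction s using Finset.induction with
  | empty =>
    intro M _ _ _ h
    have e : Submodule.torsionBySet R M ((∅ : Finset R) : Set R) = ⊤ := by
      ext; simp [Submodule.mem_torsionBySet_iff]
    rw [e] at h
    exact isArtinian_of_linearEquiv (Submodule.topEquiv (R := R) (M := M))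
  | insert x s _ ih =>
    intro M _ _ htors h
    have : IsArtinian R (Submodule.torsionBySet R (Submodule.torsionBy R M x) (s : Set R)) := by
      let j : Submodule.torsionBySet R (Submodule.torsionBy R M x) (s : Set R) →ₗ[R]
          Submodule.torsionBySet R M ((insert x s : Finset R) : Set R) :=
        LinearMap.codRestrict _ ((Submodule.subtype _).comp (Submodule.subtype _)) (by
          rintro ⟨⟨y, hy⟩, hy'⟩
          rw [Submodule.mem_torsionBySet_iff] at hy' ⊢
          rintro ⟨a, ha⟩
          rcases Finset.mem_insert.1 ha with rfl | ha
          · exact hy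
          · exact congrArg Subtype.val (hy' ⟨a, ha⟩))
      refine isArtinian_of_injective j fun a b hab ↦ ?_
      have hab' : (j a : M) = j b := congrArg Subtype.val hab
      exact Subtype.ext (Subtype.ext hab')
    have : IsArtinian R (Submodule.torsionBy R M x) := ih fun y hy z ↦ by
      obtain ⟨n, hn⟩ := htors y (Finset.mem_insert_of_mem hy) z
      exact ⟨n, Subtype.ext hn⟩
    exact isArtinian_of_isArtinian_torsionBy x (htors x (Finset.mem_insert_self x s))

end Artinian

/-! ### Artinian quotients and socle elements. -/

section Local

variable {R : Type*} [CommRing R] [IsNoetherianRing R] [IsLocalRing R]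
  {N : Type*} [AddCommGroup N] [Module R N]

open IsLocalRing

/-- A module over a noetherian local ring is artinian if it has a socle element contained in all
nonzero submodules. -/
theorem isArtinian_of_forall_mem {e : N} (he : e ≠ 0) (hm : ∀ x ∈ maximalIdeal R, x • e = 0)
    (h : ∀ W : Submodule R N, W ≠ ⊥ → e ∈ W) : IsArtinian R N := by
  classical
  obtain ⟨s, hs⟩ := (maximalIdeal R).fg_of_isNoetherianRing
  -- Otherwise `e` lies in every `𝔪 ^ n • Ry`, against Krull's intersection theorem.
  have htors : ∀ y : N, ∃ n : ℕ, maximalIdeal R ^ n • Submodule.span R {y} = ⊥ := by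
    intro y
    by_contra! hcon
    have h1 : ∀ n, e ∈ maximalIdeal R ^ n • Submodule.span R {y} := fun n ↦ h _ (hcon n)
    have hey : e ∈ Submodule.span R {y} := by simpa using h1 0
    have h2 : (⟨e, hey⟩ : Submodule.span R {y}) ∈
        (⨅ n : ℕ, maximalIdeal R ^ n • ⊤ : Submodule R (Submodule.span R {y})) := by
      refine Submodule.mem_iInf _ |>.2 fun n ↦ ?_
      have : Submodule.map (Submodule.span R {y}).subtype
          (maximalIdeal R ^ n • ⊤) = maximalIdeal R ^ n • Submodule.span R {y} := by
        rw [Submodule.map_smul'', Submodule.map_top, Submodule.range_subtype]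
      have h3 := h1 n
      rw [← this] at h3
      obtain ⟨z, hz, hze⟩ := h3
      exact (Subtype.ext hze : z = ⟨e, hey⟩) ▸ hz
    rw [Ideal.iInf_pow_smul_eq_bot_of_isLocalRing _ (maximalIdeal.isMaximal R).ne_top] at h2
    exact he (congrArg Subtype.val ((Submodule.mem_bot R).1 h2))
  -- The socle is simple: for `z ≠ 0` in it, `e = r • z`, and `r` is a unit because `e ≠ 0`.
  have hatom : IsAtom (Submodule.torsionBySet R N (s : Set R)) := by
    have hmem : ∀ z : N, z ∈ Submodule.torsionBySet R N (s : Set R) ↔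
        ∀ x ∈ maximalIdeal R, x • z = 0 := by
      intro z
      rw [Submodule.torsionBySet_eq_torsionBySet_span, hs,
        Submodule.mem_torsionBySet_iff]
      simp
    refine ⟨fun hbot ↦ ?_, fun B hB ↦ ?_⟩
    · have : e ∈ Submodule.torsionBySet R N (s : Set R) := (hmem e).2 hm
      rw [hbot] at this
      exact he ((Submodule.mem_bot R).1 this)
    · by_contra hne
      refine hB.not_ge fun z hz ↦ ?_
      by_cases hz0 : z = 0
      · simp [hz0]
      have := h (Submodule.span R {z}) (by simpa using hz0)
      obtain ⟨r, rfl⟩ := Submodule.mem_span_singleton.1 this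
      have hr : IsUnit r := by
        by_contra hr
        exact he ((hmem z).1 hz r ((mem_maximalIdeal r).2 hr))
      have := h B hne
      exact (Submodule.smul_mem_iff_of_isUnit _ hr).1 this
  have : IsSimpleModule R (Submodule.torsionBySet R N (s : Set R)) :=
    isSimpleModule_iff_isAtom.2 hatom
  refine isArtinian_of_isArtinian_torsionBySet s fun x hx y ↦ ?_
  obtain ⟨n, hn⟩ := htors y
  refine ⟨n, (Submodule.mem_bot R).1 ?_⟩
  rw [← hn]
  exact Submodule.smul_mem_smul (Ideal.pow_mem_pow (hs ▸ Ideal.subset_span hx) n)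
    (Submodule.mem_span_singleton_self y)

/-- Every nonzero socle element survives in some artinian factor module. -/
theorem exists_isArtinian_quotient_notMem {e : N} (he : e ≠ 0)
    (hm : ∀ x ∈ maximalIdeal R, x • e = 0) :
    ∃ U : Submodule R N, e ∉ U ∧ IsArtinian R (N ⧸ U) := by
  -- By maximality of `U` among submodules avoiding `e`, the image of `e` lies in every nonzero
  -- submodule of `N ⧸ U`.
  obtain ⟨U, -, hU⟩ := zorn_le_nonempty₀ {U : Submodule R N | e ∉ U} (by
    intro c hc hchain y hy
    refine ⟨sSup c, ?_, fun z hz ↦ le_sSup hz⟩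
    intro hmem
    obtain ⟨z, hz, hez⟩ := (Submodule.mem_sSup_of_directed ⟨y, hy⟩ hchain.directedOn).1 hmem
    exact hc hz hez) ⊥ (by simpa using he)
  refine ⟨U, hU.1, ?_⟩
  refine isArtinian_of_forall_mem (e := U.mkQ e) (by simpa using hU.1)
    (fun x hx ↦ by rw [← map_smul, hm x hx, map_zero]) fun W hW ↦ ?_
  by_contra hcon
  have h1 : W.comap U.mkQ = U := (hU.eq_of_le (y := W.comap U.mkQ) hcon
    (fun x hx ↦ by simp [(Submodule.Quotient.mk_eq_zero U).2 hx])).symm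
  apply hW
  rw [← Submodule.map_comap_eq_of_surjective U.mkQ_surjective W, h1, Submodule.mkQ_map_self]

/-- In an artinian quotient where `e = r • y` survives, `r` cannot act as zero. -/
theorem mem_coassociatedPrimes_of_socle {p : PrimeSpectrum R} {e : N} (he : e ≠ 0)
    (hm : ∀ x ∈ maximalIdeal R, x • e = 0) (hp : p.asIdeal ≤ Module.annihilator R N)
    (hdiv : ∀ r ∉ p.asIdeal, ∃ y : N, r • y = e) : p ∈ coassociatedPrimes R N := by
  obtain ⟨U, heU, hU⟩ := exists_isArtinian_quotient_notMem he hm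
  refine ⟨U, hU, le_antisymm (fun r hr ↦ ?_) (hp.trans ?_)⟩
  · by_contra hrp
    obtain ⟨y, rfl⟩ := hdiv r hrp
    apply heU
    rw [← Submodule.Quotient.mk_eq_zero, Submodule.Quotient.mk_smul]
    exact Module.mem_annihilator.1 hr _
  · exact LinearMap.annihilator_le_of_surjective U.mkQ U.mkQ_surjective

end Local

/-! ### Formal properties of coassociated primes. -/

theorem coassociatedPrimes_subset_of_surjective {R : Type*} [CommRing R]
    {N : Type*} [AddCommGroup N] [Module R N] {N' : Type*} [AddCommGroup N'] [Module R N']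
    (f : N →ₗ[R] N') (hf : Function.Surjective f) :
    coassociatedPrimes R N' ⊆ coassociatedPrimes R N := by
  rintro p ⟨U, hU, hp⟩
  have hs : Function.Surjective (U.mkQ.comp f) := U.mkQ_surjective.comp hf
  let e : (N ⧸ LinearMap.ker (U.mkQ.comp f)) ≃ₗ[R] N' ⧸ U :=
    (U.mkQ.comp f).quotKerEquivOfSurjective hs
  exact ⟨_, isArtinian_of_linearEquiv e.symm, by rw [e.annihilator_eq, hp]⟩

-- A quotient `Q` inherits `𝔪Q = Q`; annihilator `𝔪` would force `Q = 0`, whose annihilator is `R`.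
open IsLocalRing in
theorem coassociatedPrimes_subset_of_smul_top {R : Type*} [CommRing R] [IsLocalRing R]
    {N : Type*} [AddCommGroup N] [Module R N]
    (hN : maximalIdeal R • (⊤ : Submodule R N) = ⊤) :
    coassociatedPrimes R N ⊆ {p | Module.annihilator R N ≤ p.asIdeal ∧
      p.asIdeal < maximalIdeal R} := by
  rintro p ⟨U, -, hU⟩
  refine ⟨hU ▸ LinearMap.annihilator_le_of_surjective U.mkQ U.mkQ_surjective,
    lt_of_le_of_ne (le_maximalIdeal p.isPrime.ne_top) fun hpm ↦ ?_⟩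
  have h1 : maximalIdeal R • (⊤ : Submodule R (N ⧸ U)) = ⊤ := by
    have := congrArg (Submodule.map U.mkQ) hN
    rwa [Submodule.map_smul'', Submodule.map_top, Submodule.range_mkQ] at this
  have h2 : maximalIdeal R • (⊤ : Submodule R (N ⧸ U)) = ⊥ := by
    rw [eq_bot_iff, Submodule.smul_le]
    intro r hr y _
    rw [← hpm, ← hU] at hr
    simp [Module.mem_annihilator.1 hr y]
  apply p.isPrime.ne_top
  rw [← hU, Module.annihilator_eq_top_iff]
  rw [h1] at h2
  exact (Submodule.subsingleton_iff R).1 (subsingleton_of_bot_eq_top h2.symm)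

/-! ### The completion modulo the module. -/

namespace CompletionQuotient

open IsLocalRing

variable {R : Type*} [CommRing R] [IsLocalRing R]
  {M : Type*} [AddCommGroup M] [Module R M] {N : Type*} [AddCommGroup N] [Module R N]

/-- Each element of the completion agrees modulo `𝔪` with one from `M`, and as `𝔪` is finitely
generated the kernel of `eval` at level 1 is `𝔪` times the completion. -/
theorem smul_top [IsNoetherianRing R] :
    maximalIdeal R • (⊤ : Submodule R (CompletionQuotient R M)) = ⊤ := by
  rw [eq_top_iff]
  rintro y -
  obtain ⟨x, rfl⟩ := Submodule.mkQ_surjective _ y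
  obtain ⟨m, hm⟩ := Submodule.mkQ_surjective _ (AdicCompletion.eval (maximalIdeal R) M 1 x)
  have h1 : x - AdicCompletion.of (maximalIdeal R) M m ∈
      maximalIdeal R ^ 1 • (⊤ : Submodule R (AdicCompletion (maximalIdeal R) M)) := by
    rw [AdicCompletion.pow_smul_top_eq_ker_eval (maximalIdeal R).fg_of_isNoetherianRing,
      LinearMap.mem_ker, map_sub, AdicCompletion.eval_of, hm, sub_self]
  have h2 : (LinearMap.range (AdicCompletion.of (maximalIdeal R) M)).mkQ x =
      (LinearMap.range (AdicCompletion.of (maximalIdeal R) M)).mkQ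
        (x - AdicCompletion.of (maximalIdeal R) M m) := by
    rw [map_sub, eq_comm, sub_eq_self, Submodule.mkQ_apply, Submodule.Quotient.mk_eq_zero]
    exact ⟨m, rfl⟩
  rw [h2]
  have := Submodule.mem_map_of_mem (f := (LinearMap.range
    (AdicCompletion.of (maximalIdeal R) M)).mkQ) h1
  rwa [Submodule.map_smul'', Submodule.map_top, Submodule.range_mkQ, pow_one] at this

theorem annihilator_le : Module.annihilator R M ≤ Module.annihilator R (CompletionQuotient R M) := by
  intro r hr
  rw [Module.mem_annihilator] at hr ⊢
  intro y
  obtain ⟨x, rfl⟩ := Submodule.mkQ_surjective _ y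
  suffices h : r • x = 0 by rw [← map_smul, h, map_zero]
  refine AdicCompletion.ext fun n ↦ ?_
  obtain ⟨m, hm⟩ := Submodule.mkQ_surjective _ (x.val n)
  rw [AdicCompletion.val_smul_apply, ← hm, ← map_smul, hr, map_zero]
  rfl

/-- The map on completion quotients induced by a linear map. -/
noncomputable def map (f : M →ₗ[R] N) : CompletionQuotient R M →ₗ[R] CompletionQuotient R N :=
  Submodule.mapQ _ _ ((AdicCompletion.map (maximalIdeal R) f).restrictScalars R) (by
    rintro _ ⟨x, rfl⟩
    exact ⟨f x, (AdicCompletion.map_of (maximalIdeal R) f x).symm⟩)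

theorem map_surjective {f : M →ₗ[R] N} (hf : Function.Surjective f) :
    Function.Surjective (map f) := by
  intro y
  obtain ⟨y, rfl⟩ := Submodule.mkQ_surjective _ y
  obtain ⟨x, rfl⟩ := AdicCompletion.map_surjective (maximalIdeal R) hf y
  exact ⟨Submodule.mkQ _ x, rfl⟩

end CompletionQuotient

/-! ### Convergent sums in the completion of a direct sum. -/

section NullSequence

variable {R : Type*} [CommRing R] (I : Ideal R)
  {L : ℕ → Type*} [∀ i, AddCommGroup (L i)] [∀ i, Module R (L i)]

theorem lof_mem_smul_top {J : Ideal R} {i : ℕ} {z : L i}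
    (h : z ∈ (J • ⊤ : Submodule R (L i))) :
    DirectSum.lof R ℕ L i z ∈ (J • ⊤ : Submodule R (⨁ i, L i)) := by
  have := Submodule.mem_map_of_mem (f := DirectSum.lof R ℕ L i) h
  rw [Submodule.map_smul''] at this
  exact Submodule.smul_mono le_rfl le_top this

/-- A sequence tending to zero can be summed in the completion of the direct sum. -/
theorem exists_adicCompletion_sum (z : ∀ i, L i)
    (hz : ∀ n : ℕ, ∃ k, ∀ i, k ≤ i → z i ∈ (I ^ n • ⊤ : Submodule R (L i))) :
    ∃ x : AdicCompletion I (⨁ i, L i), ∀ n : ℕ, ∃ k, ∀ j, k ≤ j →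
      x.val n = Submodule.mkQ _ (∑ i ∈ Finset.range j, DirectSum.lof R ℕ L i (z i)) := by
  choose k hk using hz
  have hstep : ∀ n j₁ j₂, k n ≤ j₁ → j₁ ≤ j₂ →
      (I ^ n • ⊤ : Submodule R (⨁ i, L i)).mkQ
        (∑ i ∈ Finset.range j₂, DirectSum.lof R ℕ L i (z i)) =
      (I ^ n • ⊤ : Submodule R (⨁ i, L i)).mkQ
        (∑ i ∈ Finset.range j₁, DirectSum.lof R ℕ L i (z i)) := by
    intro n j₁ j₂ h1 h2
    rw [← sub_eq_zero, ← map_sub, Submodule.mkQ_apply, Submodule.Quotient.mk_eq_zero,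
      ← Finset.sum_Ico_eq_sub _ h2]
    exact Submodule.sum_mem _ fun i hi ↦ lof_mem_smul_top
      (hk n i (h1.trans (Finset.mem_Ico.1 hi).1))
  refine ⟨⟨fun n ↦ Submodule.mkQ _ (∑ i ∈ Finset.range (k n), DirectSum.lof R ℕ L i (z i)),
    fun {m n} hmn ↦ ?_⟩, fun n ↦ ⟨k n, fun j hj ↦ (hstep n _ _ le_rfl hj).symm⟩⟩
  -- The bounds `k` need not be monotone, so both partial sums are compared at the larger one.
  have e1 := hstep n _ _ le_rfl (le_max_left (k n) (k m))
  have e2 := hstep m _ _ le_rfl (le_max_right (k n) (k m))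
  dsimp only
  rw [← e1, ← e2]
  rfl

end NullSequence

/-! ### A coassociated prime from a null sequence of socle elements. -/

section

open IsLocalRing

variable {R : Type*} [CommRing R] [IsLocalRing R]
  {L : ℕ → Type*} [∀ i, AddCommGroup (L i)] [∀ i, Module R (L i)]

/-- A single `y i` must serve all `n`: it is taken in `𝔪 ^ n` for the largest possible `n ≤ i`. The
cap makes a largest `n` exist and is harmless as `i` grows. -/
theorem exists_null_sequence_smul_eq {s : ∀ i, L i} {r : R}
    (hdiv : ∀ n : ℕ, ∃ k, ∀ i, k ≤ i →
      ∃ y ∈ (maximalIdeal R ^ n • ⊤ : Submodule R (L i)), r • y = s i) :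
    ∃ y : ∀ i, L i, (∃ k, ∀ i, k ≤ i → r • y i = s i) ∧
      ∀ n : ℕ, ∃ k, ∀ i, k ≤ i → y i ∈ (maximalIdeal R ^ n • ⊤ : Submodule R (L i)) := by
  classical
  have key : ∀ i, ∃ y : L i, ∀ n ≤ i,
      (∃ z ∈ (maximalIdeal R ^ n • ⊤ : Submodule R (L i)), r • z = s i) →
        y ∈ (maximalIdeal R ^ n • ⊤ : Submodule R (L i)) ∧ r • y = s i := by
    intro i
    let P : ℕ → Prop := fun n ↦ ∃ z ∈ (maximalIdeal R ^ n • ⊤ : Submodule R (L i)), r • z = s i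
    by_cases h : ∃ n ≤ i, P n
    · obtain ⟨n, hn, hPn⟩ := h
      obtain ⟨z, hz, hrz⟩ := Nat.findGreatest_spec hn hPn
      exact ⟨z, fun m hm hPm ↦ ⟨Submodule.smul_mono_left
        (Ideal.pow_le_pow_right (Nat.le_findGreatest hm hPm)) hz, hrz⟩⟩
    · exact ⟨0, fun n hn hP ↦ (h ⟨n, hn, hP⟩).elim⟩
  choose y hy using key
  choose k hk using hdiv
  exact ⟨y, ⟨k 0, fun i hi ↦ (hy i 0 (Nat.zero_le i) (hk 0 i hi)).2⟩, fun n ↦ ⟨max n (k n),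
    fun i hi ↦ (hy i n ((le_max_left _ _).trans hi) (hk n i ((le_max_right _ _).trans hi))).1⟩⟩

theorem mem_coassociatedPrimes_completionQuotient_directSum [IsNoetherianRing R]
    {p : PrimeSpectrum R} (s : ∀ i, L i)
    (hp : ∀ i, p.asIdeal ≤ Module.annihilator R (L i)) (hs : ∀ i, s i ≠ 0)
    (hsm : ∀ i, ∀ x ∈ maximalIdeal R, x • s i = 0)
    (hL : ∀ i, ∃ n : ℕ, (maximalIdeal R ^ n • ⊤ : Submodule R (L i)) = ⊥)
    (hdiv : ∀ r ∉ p.asIdeal, ∀ n : ℕ, ∃ k, ∀ i, k ≤ i →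
      ∃ y ∈ (maximalIdeal R ^ n • ⊤ : Submodule R (L i)), r • y = s i) :
    p ∈ coassociatedPrimes R (CompletionQuotient R (⨁ i, L i)) := by
  have hnull : ∀ n : ℕ, ∃ k, ∀ i, k ≤ i →
      s i ∈ (maximalIdeal R ^ n • ⊤ : Submodule R (L i)) := by
    intro n
    obtain ⟨k, hk⟩ := hdiv 1 p.isPrime.one_notMem n
    refine ⟨k, fun i hi ↦ ?_⟩
    obtain ⟨y, hy, hys⟩ := hk i hi
    rwa [← hys, one_smul]
  obtain ⟨e, he⟩ := exists_adicCompletion_sum (maximalIdeal R) s hnull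
  set π := (LinearMap.range (AdicCompletion.of (maximalIdeal R) (⨁ i, L i))).mkQ with hπ
  refine mem_coassociatedPrimes_of_socle (e := π e) ?_ ?_ ?_ ?_
  · rw [hπ, Submodule.mkQ_apply, Ne, Submodule.Quotient.mk_eq_zero]
    rintro ⟨t, rfl⟩
    obtain ⟨i, hi⟩ : ∃ i, t i = 0 := by
      classical
      obtain ⟨i, hi⟩ := Infinite.exists_notMem_finset (DFinsupp.support t)
      exact ⟨i, by simpa using hi⟩
    -- Since `𝔪 ^ n` kills `L i`, level `n` determines the `i`-th component: it is `s i ≠ 0` for the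
    -- sum and `0` for `t`.
    obtain ⟨n, hn⟩ := hL i
    obtain ⟨k, hk⟩ := he n
    have h1 := hk (max k (i + 1)) (le_max_left _ _)
    rw [AdicCompletion.of_apply, ← sub_eq_zero, ← map_sub, Submodule.mkQ_apply,
      Submodule.Quotient.mk_eq_zero] at h1
    have h2 := Submodule.mem_map_of_mem (f := DirectSum.component R ℕ L i) h1
    rw [Submodule.map_smul''] at h2
    replace h2 := Submodule.smul_mono (le_refl (maximalIdeal R ^ n)) le_top h2
    rw [hn, Submodule.mem_bot, map_sub, map_sum, Finset.sum_eq_single i, DirectSum.component.lof_self,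
      ← DirectSum.apply_eq_component, hi, zero_sub, neg_eq_zero] at h2
    · exact hs i h2
    · intro j _ hj
      rw [DirectSum.component.of, dif_neg hj]
    · intro hi'
      exact (hi' (Finset.mem_range.2 (by omega))).elim
  · intro x hx
    suffices h : x • e = 0 by rw [← map_smul, h, map_zero]
    refine AdicCompletion.ext fun n ↦ ?_
    obtain ⟨k, hk⟩ := he n
    rw [AdicCompletion.val_smul_apply, hk k le_rfl, ← map_smul, Finset.smul_sum,
      Finset.sum_eq_zero (fun i _ ↦ by rw [← map_smul, hsm i x hx, map_zero]), map_zero]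
    rfl
  · refine le_trans (fun r hr ↦ ?_) CompletionQuotient.annihilator_le
    rw [Module.mem_annihilator]
    intro t
    ext i
    exact Module.mem_annihilator.1 (hp i hr) _
  · intro r hr
    obtain ⟨y, ⟨k, hk⟩, hy⟩ := exists_null_sequence_smul_eq (hdiv r hr)
    obtain ⟨Y, hY⟩ := exists_adicCompletion_sum (maximalIdeal R) y hy
    refine ⟨π Y, ?_⟩
    rw [← map_smul, ← sub_eq_zero, ← map_sub, hπ, Submodule.mkQ_apply,
      Submodule.Quotient.mk_eq_zero]
    -- `r • y i = s i` can fail only for `i < k`; this finite error lies in the direct sum.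
    refine ⟨∑ i ∈ Finset.range k, DirectSum.lof R ℕ L i (r • y i - s i), ?_⟩
    refine AdicCompletion.ext fun n ↦ ?_
    obtain ⟨k₁, hk₁⟩ := he n
    obtain ⟨k₂, hk₂⟩ := hY n
    have hj₁ : k₁ ≤ k + k₁ + k₂ := by omega
    have hj₂ : k₂ ≤ k + k₁ + k₂ := by omega
    rw [AdicCompletion.of_apply, AdicCompletion.val_sub_apply, AdicCompletion.val_smul_apply,
      hk₁ _ hj₁, hk₂ _ hj₂, ← map_smul, ← map_sub, Finset.smul_sum, ← Finset.sum_sub_distrib]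
    congr 1
    simp only [← map_smul, ← map_sub]
    refine Finset.sum_subset (Finset.range_mono (by omega)) fun i _ hi ↦ ?_
    rw [hk i (by simpa using hi), sub_self, map_zero]

end

/-! ### Finite modules with highly divisible socle elements. -/

section

open IsLocalRing

variable {R : Type u} [CommRing R] [IsNoetherianRing R] [IsLocalRing R]

theorem isArtinianRing_quotient_of_pow_le {a : Ideal R} {n : ℕ} (ha : maximalIdeal R ^ n ≤ a)
    [Nontrivial (R ⧸ a)] : IsArtinianRing (R ⧸ a) := by
  have : IsLocalRing (R ⧸ a) :=
    IsLocalRing.of_surjective' (Ideal.Quotient.mk a) Ideal.Quotient.mk_surjective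
  rw [isArtinianRing_iff_isNilpotent_maximalIdeal]
  refine ⟨n, ?_⟩
  have hmap : maximalIdeal (R ⧸ a) ≤ (maximalIdeal R).map (Ideal.Quotient.mk a) := by
    intro x hx
    obtain ⟨r, rfl⟩ := Ideal.Quotient.mk_surjective x
    refine Ideal.mem_map_of_mem _ ?_
    rw [mem_maximalIdeal] at hx ⊢
    exact fun h ↦ hx (h.map _)
  rw [Ideal.zero_eq_bot, eq_bot_iff]
  refine (Ideal.pow_right_mono hmap n).trans ?_
  rw [← Ideal.map_pow, Ideal.map_le_iff_le_comap]
  intro x hx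
  simpa [Ideal.Quotient.eq_zero_iff_mem] using ha hx

/-- `L` is artinian over the artinian ring `R ⧸ a`, hence finite over it. -/
theorem finite_of_isArtinian_of_pow_le {a : Ideal R} {n : ℕ} (ha : maximalIdeal R ^ n ≤ a)
    {L : Type*} [AddCommGroup L] [Module R L] [IsArtinian R L]
    (haL : a ≤ Module.annihilator R L) : Module.Finite R L := by
  rcases subsingleton_or_nontrivial (R ⧸ a) with h | h
  · have : a = ⊤ := Ideal.Quotient.subsingleton_iff.1 h
    have : Subsingleton L := by
      rw [← Module.annihilator_eq_top_iff (R := R), eq_top_iff, ← this]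
      exact haL
    infer_instance
  have : IsArtinianRing (R ⧸ a) := isArtinianRing_quotient_of_pow_le ha
  have htors : Module.IsTorsionBySet R L (a : Set R) :=
    (Module.isTorsionBySet_iff_subset_annihilator R L).2 haL
  let _ := htors.module
  have : IsScalarTower R (R ⧸ a) L := htors.isScalarTower
  have : IsArtinian (R ⧸ a) L := isArtinian_of_tower R inferInstance
  have : Module.Finite (R ⧸ a) L := ((IsArtinianRing.tfae (R ⧸ a) L).out 2 0).1 this
  exact Module.Finite.trans (R ⧸ a) L

/-- For a proper ideal `a` containing a power of the maximal ideal, there is a finite module over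
`R ⧸ a` with a nonzero socle element contained in all `r • L` with `r ∉ a`. -/
theorem exists_finite_module_socle {a : Ideal R} {n : ℕ} (ha : maximalIdeal R ^ n ≤ a)
    (ha' : a ≠ ⊤) :
    ∃ (L : ModuleCat.{u} R) (s : L), Module.Finite R L ∧ a ≤ Module.annihilator R L ∧ s ≠ 0 ∧
      (∀ x ∈ maximalIdeal R, x • s = 0) ∧ ∀ r ∉ a, ∃ y : L, r • y = s := by
  obtain ⟨χ, hχ⟩ := CharacterModule.exists_character_apply_ne_zero_of_ne_zero
    (a := (Submodule.Quotient.mk 1 : R ⧸ maximalIdeal R)) (by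
      rw [Ne, Submodule.Quotient.mk_eq_zero]
      exact (Ideal.ne_top_iff_one _).1 (maximalIdeal.isMaximal R).ne_top)
  let ρ : (R ⧸ a) →ₗ[R] R ⧸ maximalIdeal R := Submodule.factor (le_maximalIdeal ha')
  let s : CharacterModule (R ⧸ a) := CharacterModule.dual ρ χ
  have hs : s ≠ 0 := fun h ↦ hχ (DFunLike.congr_fun h (Submodule.Quotient.mk 1 : R ⧸ a))
  have hsm : ∀ x ∈ maximalIdeal R, x • s = 0 := by
    intro x hx
    ext b
    rw [CharacterModule.smul_apply]
    change χ (ρ (x • b)) = 0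
    obtain ⟨t, rfl⟩ := Submodule.mkQ_surjective _ b
    have : ρ (x • Submodule.mkQ a t) = 0 := by
      change (Submodule.Quotient.mk (x • t) : R ⧸ maximalIdeal R) = 0
      rw [Submodule.Quotient.mk_eq_zero]
      exact Ideal.mul_mem_right _ _ hx
    rw [this, map_zero]
  have hdiv : ∀ r ∉ a, ∃ y : CharacterModule (R ⧸ a), r • y = s := by
    intro r hr
    let l : (R ⧸ a) →ₗ[R] R ⧸ a := LinearMap.lsmul R _ r
    -- As `r ∉ a`, no unit is sent into `a` by `r`, so `χ ∘ ρ` factors through the image of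
    -- multiplication by `r`; divisibility of `ℚ/ℤ` extends it to `R ⧸ a`.
    have hl : LinearMap.ker l ≤ LinearMap.ker ρ := by
      intro b hb
      obtain ⟨t, rfl⟩ := Submodule.mkQ_surjective _ b
      have h1 : r * t ∈ a := by
        rw [← smul_eq_mul, ← Submodule.Quotient.mk_eq_zero]
        exact hb
      change (Submodule.Quotient.mk t : R ⧸ maximalIdeal R) = 0
      rw [Submodule.Quotient.mk_eq_zero, mem_maximalIdeal]
      intro ht
      exact hr ((Ideal.mul_unit_mem_iff_mem a ht).1 h1)
    let f : ((R ⧸ a) ⧸ LinearMap.ker l) →ₗ[R] R ⧸ a := (LinearMap.ker l).liftQ l le_rfl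
    have hf : Function.Injective f := LinearMap.ker_eq_bot.1 (Submodule.ker_liftQ_eq_bot' _ _ rfl)
    obtain ⟨y, hy⟩ := CharacterModule.dual_surjective_of_injective f hf
      (CharacterModule.dual ((LinearMap.ker l).liftQ ρ hl) χ)
    refine ⟨y, ?_⟩
    ext b
    exact DFunLike.congr_fun hy (Submodule.Quotient.mk b)
  -- The character module need not be finite; an artinian quotient killed by `a` is.
  obtain ⟨U, hU, hUa⟩ := exists_isArtinian_quotient_notMem hs hsm
  have haC : a ≤ Module.annihilator R (CharacterModule (R ⧸ a) ⧸ U) := by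
    refine le_trans (fun r hr ↦ ?_) (LinearMap.annihilator_le_of_surjective U.mkQ U.mkQ_surjective)
    rw [Module.mem_annihilator]
    intro y
    ext b
    obtain ⟨t, rfl⟩ := Submodule.mkQ_surjective _ b
    have h0 : r • Submodule.mkQ a t = 0 := by
      rw [← map_smul, Submodule.mkQ_apply]
      exact (Submodule.Quotient.mk_eq_zero a).2 (Ideal.mul_mem_right _ _ hr)
    rw [CharacterModule.smul_apply, h0, map_zero]
    rfl
  refine ⟨ModuleCat.of R (CharacterModule (R ⧸ a) ⧸ U), U.mkQ s,
    finite_of_isArtinian_of_pow_le ha haC, haC, ?_, ?_, ?_⟩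
  · simpa using hU
  · intro x hx
    rw [← map_smul, hsm x hx, map_zero]
  · intro r hr
    obtain ⟨y, hy⟩ := hdiv r hr
    exact ⟨U.mkQ y, by rw [← map_smul, hy]⟩

/-- Variant of `exists_finite_module_socle` with a module generated by images of the ideal `J`. -/
theorem exists_finite_module_socle_generated {a : Ideal R} {n : ℕ} (ha : maximalIdeal R ^ n ≤ a)
    {J : Ideal R} {c : R} (hcJ : c ∈ J) (hca : c ∉ a) :
    ∃ (L : ModuleCat.{u} R) (s : L) (G : Finset L), a ≤ Module.annihilator R L ∧ s ≠ 0 ∧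
      (∀ x ∈ maximalIdeal R, x • s = 0) ∧ (∀ r, r * c ∉ a → ∃ y : L, r • y = s) ∧
      Submodule.span R (G : Set L) = ⊤ ∧
      ∀ g ∈ G, ∃ f : (Submodule.map (Submodule.mkQ a) J) →ₗ[R] L, g ∈ LinearMap.range f := by
  obtain ⟨L, s, hfin, haL, hs, hsm, hdiv⟩ := exists_finite_module_socle ha
    (fun h ↦ hca (h ▸ Submodule.mem_top))
  -- The module sought is `J • L`: its generators `j • l` are values of the maps `1 ↦ l` on the
  -- image of `J`, and `s = c • y₀` belongs to it.
  let W : Submodule R L := J • ⊤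
  obtain ⟨y₀, hy₀⟩ := hdiv c hca
  have hsW : s ∈ W := hy₀ ▸ Submodule.smul_mem_smul hcJ Submodule.mem_top
  let S : Set L := {x | ∃ j ∈ J, ∃ l : L, j • l = x}
  have hWS : W = Submodule.span R S := by
    refine le_antisymm (Submodule.smul_le.2 fun j hj l _ ↦ Submodule.subset_span ⟨j, hj, l, rfl⟩)
      (Submodule.span_le.2 ?_)
    rintro _ ⟨j, hj, l, rfl⟩
    exact Submodule.smul_mem_smul hj Submodule.mem_top
  have hspan : Submodule.span R ((↑) ⁻¹' S : Set W) = ⊤ := by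
    rw [eq_top_iff]
    rintro ⟨x, hx⟩ -
    have h1 : S ⊆ W := by rw [hWS]; exact Submodule.subset_span
    have h2 : (Submodule.span R ((↑) ⁻¹' S : Set W)).map W.subtype = W := by
      rw [Submodule.map_span]
      conv_rhs => rw [hWS]
      congr 1
      exact Subtype.image_preimage_coe _ _ |>.trans (Set.inter_eq_right.2 h1)
    rw [← h2] at hx
    obtain ⟨z, hz, rfl⟩ := hx
    exact hz
  obtain ⟨G, hG, hGspan⟩ := (Submodule.fg_span_iff_fg_span_finset_subset
    ((↑) ⁻¹' S : Set W)).1 (hspan ▸ (inferInstance : Module.Finite R W).fg_top)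
  refine ⟨ModuleCat.of R W, ⟨s, hsW⟩, G, ?_, ?_, ?_, ?_, ?_, ?_⟩
  · exact haL.trans (LinearMap.annihilator_le_of_injective W.subtype W.injective_subtype)
  · exact fun h ↦ hs (congrArg Subtype.val h)
  · exact fun x hx ↦ Subtype.ext (hsm x hx)
  · intro r hr
    obtain ⟨y, hy⟩ := hdiv _ hr
    exact ⟨⟨c • y, Submodule.smul_mem_smul hcJ Submodule.mem_top⟩,
      Subtype.ext ((mul_smul r c y).symm.trans hy)⟩
  · exact hGspan.symm.trans hspan
  · intro g hg
    obtain ⟨j, hj, l, hjl⟩ := hG hg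
    let f₀ : (R ⧸ a) →ₗ[R] L := Submodule.liftQ a (LinearMap.toSpanSingleton R L l) (fun r hr ↦
      Module.mem_annihilator.1 (haL hr) l)
    refine ⟨LinearMap.codRestrict W (f₀.domRestrict _) ?_,
      ⟨Submodule.mkQ a j, Submodule.mem_map_of_mem hj⟩, Subtype.ext hjl⟩
    rintro ⟨_, j', hj', rfl⟩
    exact Submodule.smul_mem_smul hj' Submodule.mem_top

end

/-! ### Reduction to maps from the summands. -/

section

open IsLocalRing

variable {R : Type u} [CommRing R] [IsNoetherianRing R] [IsLocalRing R]

/-- Krull's intersection theorem in `R ⧸ p`. -/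
theorem exists_forall_notMem_sup_pow (p : Ideal R) {r : R} (hr : r ∉ p) :
    ∃ k, ∀ i, k ≤ i → r ∉ p ⊔ maximalIdeal R ^ i := by
  have h1 : (Submodule.mkQ p r) ∉
      (⨅ n : ℕ, maximalIdeal R ^ n • ⊤ : Submodule R (R ⧸ p)) := by
    rw [Ideal.iInf_pow_smul_eq_bot_of_isLocalRing _ (maximalIdeal.isMaximal R).ne_top]
    simpa [Submodule.Quotient.mk_eq_zero, Ideal.Quotient.eq_zero_iff_mem] using hr
  rw [Submodule.mem_iInf] at h1
  push Not at h1
  obtain ⟨k, hk⟩ := h1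
  refine ⟨k, fun i hi hmem ↦ hk ?_⟩
  obtain ⟨q, hq, t, ht, rfl⟩ := Submodule.mem_sup.1 hmem
  have hq0 : Submodule.mkQ p q = 0 := (Submodule.Quotient.mk_eq_zero p).2 hq
  rw [map_add, hq0, zero_add]
  have h2 := Submodule.smul_mem_smul (Ideal.pow_le_pow_right hi ht)
    (Submodule.mem_top : Submodule.mkQ p (1 : R) ∈ ⊤)
  rwa [← map_smul, smul_eq_mul, mul_one] at h2

/-- The generators of all `L k` are countably many, so each gets its own index in `S`; unused
summands map to zero. -/
theorem exists_linearMap_directSum_surjective {R : Type*} [CommRing R] {I : Type w} {M : I → Type v}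
    [∀ i, AddCommGroup (M i)] [∀ i, Module R (M i)] {L : ℕ → Type*} [∀ k, AddCommGroup (L k)]
    [∀ k, Module R (L k)] {S : Set I} (hS : S.Infinite) (G : ∀ k, Finset (L k))
    (hG : ∀ k, Submodule.span R (G k : Set (L k)) = ⊤)
    (h : ∀ i ∈ S, ∀ k, ∀ g ∈ G k, ∃ f : M i →ₗ[R] L k, g ∈ LinearMap.range f) :
    ∃ F : (⨁ i, M i) →ₗ[R] ⨁ k, L k, Function.Surjective F := by
  classical
  have := hS.to_subtype
  obtain ⟨e₁⟩ := nonempty_embedding_nat (Σ k, G k)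
  let ι : (Σ k, G k) → I := fun γ ↦ (Infinite.natEmbedding S (e₁ γ)).1
  have hι : Function.Injective ι :=
    Subtype.val_injective.comp ((Infinite.natEmbedding S).injective.comp e₁.injective)
  have key : ∀ i, ∃ f : M i →ₗ[R] ⨁ k, L k, ∀ γ : Σ k, G k, ι γ = i →
      DirectSum.lof R ℕ L γ.1 γ.2 ∈ LinearMap.range f := by
    intro i
    by_cases hi : ∃ γ, ι γ = i
    · obtain ⟨γ, rfl⟩ := hi
      obtain ⟨f, x, hx⟩ := h (ι γ) (Infinite.natEmbedding S (e₁ γ)).2 γ.1 γ.2 γ.2.2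
      refine ⟨(DirectSum.lof R ℕ L γ.1).comp f, fun δ hδ ↦ ?_⟩
      obtain rfl := hι hδ
      exact ⟨x, by rw [LinearMap.comp_apply, hx]⟩
    · exact ⟨0, fun γ hγ ↦ (hi ⟨γ, hγ⟩).elim⟩
  choose f hf using key
  refine ⟨DirectSum.toModule R I _ f, LinearMap.range_eq_top.1 (eq_top_iff.2 fun t _ ↦ ?_)⟩
  have h1 : ∀ k (l : L k),
      DirectSum.lof R ℕ L k l ∈ LinearMap.range (DirectSum.toModule R I _ f) := by
    intro k
    have : Submodule.span R (G k : Set (L k)) ≤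
        (LinearMap.range (DirectSum.toModule R I _ f)).comap (DirectSum.lof R ℕ L k) := by
      rw [Submodule.span_le]
      intro g hg
      obtain ⟨x, hx⟩ := hf (ι ⟨k, g, hg⟩) ⟨k, g, hg⟩ rfl
      exact ⟨DirectSum.lof R I M _ x, by rw [DirectSum.toModule_lof, hx]⟩
    rw [hG k, top_le_iff] at this
    intro l
    have hl : l ∈ (⊤ : Submodule R (L k)) := Submodule.mem_top
    rwa [← this] at hl
  induction t using DirectSum.induction_on with
  | zero => exact Submodule.zero_mem _
  | of k l => exact h1 k l
  | add a b ha hb => exact Submodule.add_mem _ (ha trivial) (hb trivial)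

/-- If infinitely many `M i` surject, for all `n`, onto the image of `J` in `R ⧸ (p + 𝔪 ^ n)`,
for some ideal `J` not contained in the prime `p`, then `p` is coassociated to the completion
quotient of the direct sum. -/
theorem mem_coassociatedPrimes_completionQuotient {I : Type w} {M : I → Type v}
    [∀ i, AddCommGroup (M i)] [∀ i, Module R (M i)] {p : PrimeSpectrum R}
    (hp : p.asIdeal < maximalIdeal R) {J : Ideal R} (hJ : ¬ J ≤ p.asIdeal)
    {S : Set I} (hS : S.Infinite)
    (h : ∀ i ∈ S, ∀ n : ℕ, ∃ φ : M i →ₗ[R] R ⧸ (p.asIdeal ⊔ maximalIdeal R ^ n),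
      LinearMap.range φ = Submodule.map (Submodule.mkQ _) J) :
    p ∈ coassociatedPrimes R (CompletionQuotient R (⨁ i, M i)) := by
  obtain ⟨c, hcJ, hcp⟩ := SetLike.not_le_iff_exists.1 hJ
  obtain ⟨x, hxm, hxp⟩ := SetLike.exists_of_lt hp
  obtain ⟨N, hN⟩ := exists_forall_notMem_sup_pow p.asIdeal hcp
  choose L s G haL hs hsm hdiv hspan hgen using fun i : ℕ ↦
    exists_finite_module_socle_generated (a := p.asIdeal ⊔ maximalIdeal R ^ (N + i)) le_sup_right
      hcJ (hN _ (Nat.le_add_right N i))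
  obtain ⟨F, hF⟩ := exists_linearMap_directSum_surjective (M := M) (L := fun i ↦ L i) hS G hspan
    (by
      intro i hi k g hg
      obtain ⟨f, y, hy⟩ := hgen k g hg
      obtain ⟨φ, hφ⟩ := h i hi (N + k)
      obtain ⟨z, hz⟩ := hφ.ge y.2
      refine ⟨f.comp (φ.codRestrict _ fun x ↦ hφ.le ⟨x, rfl⟩), z, ?_⟩
      rw [← hy, LinearMap.comp_apply]
      exact congrArg f (Subtype.ext hz))
  refine coassociatedPrimes_subset_of_surjective _ (CompletionQuotient.map_surjective hF) ?_
  refine mem_coassociatedPrimes_completionQuotient_directSum s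
    (fun i ↦ le_sup_left.trans (haL i)) hs hsm (fun i ↦ ⟨N + i, ?_⟩) fun r hr n ↦ ?_
  · rw [eq_bot_iff, Submodule.smul_le]
    intro r hr y _
    exact (Submodule.mem_bot R).2
      (Module.mem_annihilator.1 (haL i (Submodule.mem_sup_right hr)) y)
  -- Dividing by `r * x ^ n` with `x ∈ 𝔪 \ p` instead of `r` yields a quotient `x ^ n • y` in `𝔪 ^ n
  -- • L i`; the factor `c` is what `hdiv` demands.
  · have hrx : r * x ^ n * c ∉ p.asIdeal := by
      have := p.isPrime
      intro hmem
      rcases this.mem_or_mem hmem with h1 | h1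
      · rcases this.mem_or_mem h1 with h2 | h2
        · exact hr h2
        · exact hxp (this.mem_of_pow_mem _ h2)
      · exact hcp h1
    obtain ⟨k, hk⟩ := exists_forall_notMem_sup_pow p.asIdeal hrx
    refine ⟨k, fun i hi ↦ ?_⟩
    obtain ⟨y, hy⟩ := hdiv i _ (hk (N + i) (by omega))
    exact ⟨x ^ n • y, Submodule.smul_mem_smul (Ideal.pow_mem_pow hxm n) Submodule.mem_top,
      by rw [← hy, mul_smul]⟩

end

/-! ### Maps from finite and flat modules, and the conclusion. -/

section

open IsLocalRing

/-- As `p` is in the support of `X`, a functional on `κ(p) ⊗ X` gives a nonzero map `X → κ(p)`;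
clearing the denominators of finitely many generators lands it in `R ⧸ p`. -/
theorem exists_linearMap_quotient_ne_zero {R : Type*} [CommRing R] {X : Type*} [AddCommGroup X]
    [Module R X] [Module.Finite R X] (p : PrimeSpectrum R)
    (hp : Module.annihilator R X ≤ p.asIdeal) : ∃ φ : X →ₗ[R] R ⧸ p.asIdeal, φ ≠ 0 := by
  classical
  have hV : Nontrivial (p.asIdeal.ResidueField ⊗[R] X) :=
    (Module.mem_support_iff_nontrivial_residueField_tensorProduct p).1
      (Module.mem_support_iff_of_finite.2 hp)
  obtain ⟨v, hv⟩ := exists_ne (0 : p.asIdeal.ResidueField ⊗[R] X)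
  obtain ⟨l, hl⟩ : ∃ l : Module.Dual p.asIdeal.ResidueField (p.asIdeal.ResidueField ⊗[R] X),
      l v ≠ 0 := by
    by_contra! hcon
    exact hv ((Module.forall_dual_apply_eq_zero_iff _ v).1 hcon)
  let g : X →ₗ[R] p.asIdeal.ResidueField :=
    (l.restrictScalars R).comp (TensorProduct.mk R p.asIdeal.ResidueField X 1)
  obtain ⟨x₀, hx₀⟩ : ∃ x, g x ≠ 0 := by
    by_contra! hcon
    have : l = 0 := by
      refine TensorProduct.AlgebraTensorModule.curry_injective ?_
      ext x
      exact hcon x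
    exact hl (by rw [this, LinearMap.zero_apply])
  let a : (R ⧸ p.asIdeal) →ₗ[R] p.asIdeal.ResidueField :=
    (IsScalarTower.toAlgHom R (R ⧸ p.asIdeal) p.asIdeal.ResidueField).toLinearMap
  have ha : Function.Injective a :=
    IsFractionRing.injective (R ⧸ p.asIdeal) p.asIdeal.ResidueField
  obtain ⟨s, hs⟩ := (inferInstance : Module.Finite R X).fg_top
  obtain ⟨b, hb⟩ := IsLocalization.exist_integer_multiples_of_finset
    (nonZeroDivisors (R ⧸ p.asIdeal)) (s.image g)
  obtain ⟨r, hr⟩ := Ideal.Quotient.mk_surjective (b : R ⧸ p.asIdeal)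
  have hsmul : ∀ z : p.asIdeal.ResidueField, r • z = (b : R ⧸ p.asIdeal) • z := by
    intro z
    rw [← hr, ← Ideal.Quotient.algebraMap_eq, algebraMap_smul]
  have hrange : ∀ x, (r • g) x ∈ LinearMap.range a := by
    have : Submodule.span R (s : Set X) ≤ (LinearMap.range a).comap (r • g) := by
      rw [Submodule.span_le]
      intro x hx
      obtain ⟨d, hd⟩ := hb (g x) (Finset.mem_image_of_mem g hx)
      refine ⟨d, ?_⟩
      rw [LinearMap.smul_apply, hsmul]
      exact hd
    rw [hs] at this
    exact fun x ↦ this Submodule.mem_top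
  refine ⟨(LinearEquiv.ofInjective a ha).symm.toLinearMap.comp
    ((r • g).codRestrict _ hrange), fun h0 ↦ ?_⟩
  have h1 := LinearMap.congr_fun h0 x₀
  rw [LinearMap.comp_apply, LinearMap.zero_apply, LinearEquiv.coe_coe,
    LinearEquiv.map_eq_zero_iff] at h1
  have h2 : r • g x₀ = 0 := congrArg Subtype.val h1
  rw [hsmul, Algebra.smul_def, mul_eq_zero] at h2
  rcases h2 with h2 | h2
  · rw [map_eq_zero_iff _ (IsFractionRing.injective (R ⧸ p.asIdeal) p.asIdeal.ResidueField)] at h2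
    exact nonZeroDivisors.coe_ne_zero b h2
  · exact hx₀ h2

/-- A lifted basis of `F ⧸ 𝔪F` is independent by flatness and spans by Nakayama for a nilpotent
ideal, without finiteness of `F`. -/
theorem Module.Free.of_flat_of_isNilpotent {B : Type*} [CommRing B] [IsLocalRing B]
    (hB : IsNilpotent (maximalIdeal B)) {F : Type*} [AddCommGroup F] [Module B F]
    [Module.Flat B F] : Module.Free B F := by
  let w := Module.Free.chooseBasis (ResidueField B) (ResidueField B ⊗[B] F)
  obtain ⟨v, hv⟩ := (TensorProduct.mk_surjective B F (ResidueField B)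
    Ideal.Quotient.mk_surjective).comp_left w
  replace hv : TensorProduct.mk B (ResidueField B) F 1 ∘ v = w := hv
  refine .of_basis <| .mk (Module.IsLocalRing.linearIndependent_of_flat v
    (hv ▸ w.linearIndependent)) ?_
  have h1 : ⊤ ≤ Submodule.span B (Set.range v) ⊔ maximalIdeal B • ⊤ := by
    intro x _
    have hx : TensorProduct.mk B (ResidueField B) F 1 x ∈
        Submodule.span (ResidueField B) (Set.range w) := by
      rw [w.span_eq]
      trivial
    rw [← Submodule.restrictScalars_mem B, Submodule.restrictScalars_span B (ResidueField B)
      Ideal.Quotient.mk_surjective, ← hv, Set.range_comp,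
      ← Submodule.map_span] at hx
    obtain ⟨n, hn, hnx⟩ := hx
    have hker : x - n ∈ LinearMap.ker (TensorProduct.mk B (B ⧸ maximalIdeal B) F 1) := by
      rw [LinearMap.mem_ker, map_sub, sub_eq_zero]
      exact hnx.symm
    rw [LinearMap.ker_tensorProductMk] at hker
    exact Submodule.mem_sup.2 ⟨n, hn, x - n, hker, by abel⟩
  have h2 : ∀ n : ℕ, ⊤ ≤ Submodule.span B (Set.range v) ⊔ maximalIdeal B ^ n • ⊤ := by
    intro n
    induction n with
    | zero => simp
    | succ n ih =>
      refine ih.trans (sup_le le_sup_left ?_)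
      calc maximalIdeal B ^ n • (⊤ : Submodule B F)
          ≤ maximalIdeal B ^ n • (Submodule.span B (Set.range v) ⊔ maximalIdeal B • ⊤) :=
            Submodule.smul_mono le_rfl h1
        _ ≤ _ := by
            rw [Submodule.smul_sup, ← Submodule.mul_smul, ← pow_succ]
            exact sup_le_sup_right Submodule.smul_le_right _
  obtain ⟨n, hn⟩ := hB
  simpa [hn] using h2 n

variable {R : Type u} [CommRing R] [IsNoetherianRing R] [IsLocalRing R]

/-- The map is a coordinate of the free module `(R ⧸ a) ⊗ M`. Were that zero, `𝔪 ^ k M = M` for all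
`k`, against separatedness. -/
theorem exists_surjective_quotient_of_flat {a : Ideal R} {n : ℕ} (ha : maximalIdeal R ^ n ≤ a)
    {M : Type v} [AddCommGroup M] [Module R M] [Module.Flat R M]
    [IsHausdorff (maximalIdeal R) M] [Nontrivial M] :
    ∃ φ : M →ₗ[R] R ⧸ a, Function.Surjective φ := by
  rcases subsingleton_or_nontrivial (R ⧸ a) with h | h
  · exact ⟨0, fun y ↦ ⟨0, Subsingleton.elim _ _⟩⟩
  have : IsLocalRing (R ⧸ a) :=
    IsLocalRing.of_surjective' (Ideal.Quotient.mk a) Ideal.Quotient.mk_surjective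
  have : IsArtinianRing (R ⧸ a) := isArtinianRing_quotient_of_pow_le ha
  have hfree : Module.Free (R ⧸ a) ((R ⧸ a) ⊗[R] M) :=
    .of_flat_of_isNilpotent ((isArtinianRing_iff_isNilpotent_maximalIdeal _).1 this)
  have hnt : Nontrivial ((R ⧸ a) ⊗[R] M) := by
    by_contra hcon
    rw [not_nontrivial_iff_subsingleton] at hcon
    have h1 : (a • ⊤ : Submodule R M) = ⊤ := by
      rw [← LinearMap.ker_tensorProductMk, eq_top_iff]
      exact fun x _ ↦ Subsingleton.elim _ _
    have h2 : (maximalIdeal R • ⊤ : Submodule R M) = ⊤ :=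
      top_le_iff.1 (h1.ge.trans (Submodule.smul_mono_left
        (le_maximalIdeal (Ideal.Quotient.nontrivial_iff.1 h))))
    have h3 : ∀ k : ℕ, (maximalIdeal R ^ k • ⊤ : Submodule R M) = ⊤ := by
      intro k
      induction k with
      | zero => simp
      | succ k ih => rw [pow_succ, Submodule.mul_smul, h2, ih]
    obtain ⟨x, hx⟩ := exists_ne (0 : M)
    exact hx (IsHausdorff.haus ‹_› x fun k ↦ by rw [SModEq.zero, h3]; trivial)
  let b := Module.Free.chooseBasis (R ⧸ a) ((R ⧸ a) ⊗[R] M)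
  obtain ⟨i⟩ := b.index_nonempty
  refine ⟨((b.coord i).restrictScalars R).comp (TensorProduct.mk R (R ⧸ a) M 1), ?_⟩
  have hcoord : Function.Surjective ((b.coord i).restrictScalars R) :=
    fun y ↦ ⟨y • b i, by simp⟩
  exact hcoord.comp (TensorProduct.mk_surjective R M (R ⧸ a) Ideal.Quotient.mk_surjective)

theorem IsHausdorff.of_linearMap_injective {A : Type*} [CommRing A] {I : Ideal A}
    {M N : Type*} [AddCommGroup M] [Module A M] [AddCommGroup N] [Module A N] [IsHausdorff I N]
    (f : M →ₗ[A] N) (hf : Function.Injective f) : IsHausdorff I M := by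
  refine ⟨fun x hx ↦ hf ?_⟩
  rw [map_zero]
  refine IsHausdorff.haus ‹_› _ fun n ↦ ?_
  have := Submodule.mem_map_of_mem (f := f) (SModEq.zero.1 (hx n))
  rw [Submodule.map_smul''] at this
  exact SModEq.zero.2 (Submodule.smul_mono le_rfl le_top this)

theorem IsTotallySeparatedModule.isHausdorff_directSum_component {R : Type u} [CommRing R]
    [IsLocalRing R] {I : Type w} {M : I → Type v}
    [∀ i, AddCommGroup (M i)] [∀ i, Module R (M i)]
    (h : IsTotallySeparatedModule R (⨁ i, M i)) (i : I) : IsHausdorff (maximalIdeal R) (M i) := by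
  classical
  have := h R inferInstance
  exact .of_linearMap_injective
    ((TensorProduct.lid R (⨁ i, M i)).symm.toLinearMap.comp (DirectSum.lof R I M i))
    ((TensorProduct.lid R (⨁ i, M i)).symm.injective.comp (DirectSum.of_injective i))

theorem coassociatedPrimes_completionQuotient_directSum_of_flat {I : Type w} {M : I → Type v}
    [∀ i, AddCommGroup (M i)] [∀ i, Module R (M i)]
    (hsep : IsTotallySeparatedModule R (⨁ i, M i)) (hflat : Module.Flat R (⨁ i, M i))
    (hinf : {i | Nontrivial (M i)}.Infinite) :
    coassociatedPrimes R (CompletionQuotient R (⨁ i, M i)) =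
      Set.univ \ {IsLocalRing.closedPoint R} := by
  refine Set.Subset.antisymm (fun p hp ↦ ⟨trivial, ?_⟩) ?_
  · rintro rfl
    exact (coassociatedPrimes_subset_of_smul_top CompletionQuotient.smul_top hp).2.ne rfl
  · rintro p ⟨-, hp⟩
    have hp' : p.asIdeal < maximalIdeal R := lt_of_le_of_ne
      (le_maximalIdeal p.isPrime.ne_top) fun h ↦ hp (PrimeSpectrum.ext h)
    refine mem_coassociatedPrimes_completionQuotient hp' (J := ⊤)
      (fun h ↦ p.isPrime.ne_top (top_le_iff.1 h)) hinf fun i hi n ↦ ?_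
    have : Nontrivial (M i) := hi
    have := Module.Flat.directSum_iff.1 hflat i
    have := hsep.isHausdorff_directSum_component i
    obtain ⟨φ, hφ⟩ := exists_surjective_quotient_of_flat (M := M i)
      (a := p.asIdeal ⊔ maximalIdeal R ^ n) le_sup_right
    refine ⟨φ, ?_⟩
    rw [LinearMap.range_eq_top.2 hφ, Submodule.map_top, Submodule.range_mkQ]

theorem coassociatedPrimes_completionQuotient_finsupp {I : Type w} [Infinite I]
    {X : Type v} [AddCommGroup X] [Module R X] [Module.Finite R X] :
    coassociatedPrimes R (CompletionQuotient R (I →₀ X)) =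
      {p : PrimeSpectrum R | Module.annihilator R X ≤ p.asIdeal ∧
        p.asIdeal < maximalIdeal R} := by
  classical
  refine Set.Subset.antisymm (fun p hp ↦ ?_) ?_
  · have h := coassociatedPrimes_subset_of_smul_top CompletionQuotient.smul_top hp
    refine ⟨le_trans (fun r hr ↦ ?_) (CompletionQuotient.annihilator_le.trans h.1), h.2⟩
    rw [Module.mem_annihilator] at hr ⊢
    exact fun f ↦ Finsupp.ext fun i ↦ hr (f i)
  · rintro p ⟨hpX, hp⟩
    refine coassociatedPrimes_subset_of_surjective _ (CompletionQuotient.map_surjective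
      (finsuppLEquivDirectSum R X I).surjective) ?_
    obtain ⟨φ, hφ⟩ := exists_linearMap_quotient_ne_zero p hpX
    -- One `J` serves every `n`: `φ` followed by `R ⧸ p → R ⧸ (p + 𝔪 ^ n)` has the image of `J` as
    -- range. Moreover `J ⊄ p` because `φ ≠ 0`.
    let J : Ideal R := Submodule.comap (Submodule.mkQ p.asIdeal) (LinearMap.range φ)
    have hJmap : Submodule.map (Submodule.mkQ p.asIdeal) J = LinearMap.range φ :=
      Submodule.map_comap_eq_of_surjective (Submodule.mkQ_surjective _) _
    refine mem_coassociatedPrimes_completionQuotient hp (J := J) (fun hJ ↦ hφ ?_)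
      Set.infinite_univ fun i _ n ↦ ?_
    · rw [← LinearMap.range_eq_bot, ← hJmap, eq_bot_iff, ← Submodule.mkQ_map_self p.asIdeal]
      exact Submodule.map_mono hJ
    · refine ⟨(Submodule.factor le_sup_left).comp φ, ?_⟩
      rw [LinearMap.range_comp, ← hJmap, ← Submodule.map_comp, Submodule.factor_comp_mk]

end

theorem mainTheorem12 (R : Type u) [CommRing R] [IsNoetherianRing R] [IsLocalRing R]
    (I : Type w) :
    (∀ (M : I → Type v) [∀ i, AddCommGroup (M i)] [∀ i, Module R (M i)],
      IsTotallySeparatedModule R (⨁ i, M i) → Module.Flat R (⨁ i, M i) →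
      {i | Nontrivial (M i)}.Infinite →
      coassociatedPrimes R (CompletionQuotient R (⨁ i, M i)) =
        Set.univ \ {IsLocalRing.closedPoint R}) ∧
    (∀ (X : Type v) [AddCommGroup X] [Module R X],
      Module.Finite R X → Nontrivial X → Infinite I →
      coassociatedPrimes R (CompletionQuotient R (I →₀ X)) =
        {p : PrimeSpectrum R | Module.annihilator R X ≤ p.asIdeal ∧
          p.asIdeal < IsLocalRing.maximalIdeal R}) := by
  exact ⟨fun M _ _ ↦ coassociatedPrimes_completionQuotient_directSum_of_flat,
    fun X _ _ _ _ _ ↦ coassociatedPrimes_completionQuotient_finsupp⟩
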